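/- For $a\in\mathbb C$ and $n\in\mathbb N_0$ let $(a)_n=a(a+1)\cdots(a+n-1)$, and for $j\in\mathbb N_0$ let $(a)_{-j}=1/(a-j)_j$ (so that $1/(a)_{-j}=(a-j)_j$, also where this is $0$). For $k\in\mathbb N_0$ and $\tau,x\in\mathbb C$ let $$C_k^{\tau}(x)=\sum_{j=0}^{\lfloor k/2\rfloor}\frac{(-1)^j(\tau)_{k-j}}{j!\,(k-2j)!}(2x)^{k-2j}$$ be the Gegenbauer polynomials. Put $$\Lambda_1(k,m,\mu)=\frac{(-1)^{k+m}2^{2m}(2k+2\mu)_{k-2m}\,(\mu+\tfrac12)_{k-m}}{(\tfrac12+\mu+k)_{k-2m}\,(2\mu+k+1)_{k-m}},\qquad \Lambda_2(l,n,\mu)=\frac{(-1)^{n+l}(-4l-2\mu)_n\,(\mu+l+\tfrac12)_{n-l}}{2^{2l}(\tfrac12-2l-\mu)_n\,(2\mu+3l+1)_{n-l}} .$$ Let $x\in\mathbb C\setminus\{0\}$ and $\mu\in\mathbb C$. (1) For every $k\in\mathbb N_0$, $$C_k^{\mu+1/2}(x)=\sum_{m=0}^{\lfloor k/2\rfloor}\Lambda_1(k,m,\mu)\,x^{m}\,C_{k-2m}^{\frac12-2k+2m-\mu}(x)\,C_m^{k-m+\mu+\frac12}\!\left(\frac{1+x^2}{2x}\right)$$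 whenever $(\tfrac12+\mu+k)_k\neq0$ and $(2\mu+k+1)_k\ne0$. (2) For every $l\in\mathbb N_0$, $$x^{l}C_l^{\mu+l+1/2}\!\left(\frac{1+x^2}{2x}\right)=\sum_{n=0}^{2l}\Lambda_2(l,n,\mu)\,C_n^{\frac12+2l+\mu-n}(x)\,C_{2l-n}^{\mu+n+\frac12}(x)$$ whenever $(\tfrac12-2l-\mu)_{2l}\ne0$, $(2\mu+3l+1)_l\neq0$ and $(\mu+\tfrac12)_l\ne0$. For the finitely many remaining $\mu$ (for given $k$ or $l$), where a coefficient has a vanishing denominator, the identities hold with the right-hand side replaced by its limit: for every $\mu\in\mathbb C$ and $x\ne0$, the right-hand side of (1), respectively (2), taken at the parameter $\nu\ne\mu$, tends to the left-hand side at $\mu$ as $\nu\to\mu$. -/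

import Mathlib

open Filter Topology

noncomputable section

/-- The rising factorial `(a)_n = a (a + 1) ⋯ (a + n - 1)`, extended to negative integer indices
by `(a)_{-j} = 1 / (a - j)_j`, that is, by the rule `(a)_n = Γ(a + n) / Γ(a)`. -/
def poch (a : ℂ) : ℤ → ℂ
  | Int.ofNat n => (ascPochhammer ℂ n).eval a
  | Int.negSucc n => ((ascPochhammer ℂ (n + 1)).eval (a - (n + 1)))⁻¹

/-- The Gegenbauer polynomial
`C_k^τ(x) = ∑_{j = 0}^{⌊k/2⌋} (-1)^j (τ)_{k-j} / (j! (k-2j)!) (2x)^{k-2j}`. Here `(τ)_{k-j}`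
is `Γ(k - j + τ) / Γ(τ)`, continued to the non-positive integers `τ`. -/
def gegenbauerC (k : ℕ) (τ x : ℂ) : ℂ :=
  ∑ j ∈ Finset.range (k / 2 + 1),
    (-1) ^ j * (ascPochhammer ℂ (k - j)).eval τ /
      ((Nat.factorial j : ℂ) * (Nat.factorial (k - 2 * j) : ℂ)) * (2 * x) ^ (k - 2 * j)

/-- The coefficient `Λ₁(k, m, μ)`, used for `m ≤ ⌊k/2⌋`. -/
def Lambda1 (k m : ℕ) (μ : ℂ) : ℂ :=
  (-1) ^ (k + m) * 2 ^ (2 * m) * poch (2 * k + 2 * μ) ((k : ℤ) - 2 * m)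
      * poch (μ + 1 / 2) ((k : ℤ) - m) /
    (poch (1 / 2 + μ + k) ((k : ℤ) - 2 * m) * poch (2 * μ + k + 1) ((k : ℤ) - m))

/-- The coefficient `Λ₂(l, n, μ)`, used for `n ≤ 2l`; the index `n - l` may be negative. -/
def Lambda2 (l n : ℕ) (μ : ℂ) : ℂ :=
  (-1) ^ (n + l) * poch (-4 * l - 2 * μ) n * poch (μ + l + 1 / 2) ((n : ℤ) - l) /
    (2 ^ (2 * l) * poch (1 / 2 - 2 * l - μ) n * poch (2 * μ + 3 * l + 1) ((n : ℤ) - l))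

/-- The finite sum expanding `C_k^{μ+1/2}(x)`. -/
def sum1 (k : ℕ) (μ x : ℂ) : ℂ :=
  ∑ m ∈ Finset.range (k / 2 + 1),
    Lambda1 k m μ * x ^ m * gegenbauerC (k - 2 * m) (1 / 2 - 2 * k + 2 * m - μ) x
      * gegenbauerC m (k - m + μ + 1 / 2) ((1 + x ^ 2) / (2 * x))

/-- The finite sum expanding `x^l C_l^{μ+l+1/2}((1 + x²) / (2x))`. -/
def sum2 (l : ℕ) (μ x : ℂ) : ℂ :=
  ∑ n ∈ Finset.range (2 * l + 1),
    Lambda2 l n μ * gegenbauerC n (1 / 2 + 2 * l + μ - n) x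
      * gegenbauerC (2 * l - n) (μ + n + 1 / 2) x

end

/-! Write Q_x(z) = 1 - 2xz + (x² - 1)z² = (1 - xz)² - z². If τ + k + β = 1/2, then C_k^τ(x) is, up
to a ratio of rising factorials, the coefficient of z^k in Q_x^{-β} (`rf_mul_gegenbauerC`). For
fixed β the parameter τ varies with the degree, and this produces the shifted parameters in both
expansions.

With y = (1 + x²)/(2x), both Q_x(z) Q_x(-z) and Q_y(2xz²) equal 1 - 2(1 + x²)z² + (1 - x²)²z⁴
(`quadSeries_mul_rescale`). Raise this to the power -β. The coefficient of z^{2l} with β = -2l - μ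
gives (2). Dividing by Q_x(-z)^{-β} and taking the coefficient of z^k with β = -μ - k gives (1). The
Λ's collect the normalising ratios.

The limit statements follow because the excluded parameters are finite in number and the left-hand
sides are polynomial in μ. -/

noncomputable section

/-! ### Complex powers of power series through Q Y' = a Q' Y. -/

open PowerSeries in
/-- `IsPow Q a Y` says that `Y` is the power `Q ^ a`, through its differential equation. -/
def IsPow (Q : PowerSeries ℂ) (a : ℂ) (Y : PowerSeries ℂ) : Prop :=
  Q * derivative ℂ Y = C a * derivative ℂ Q * Y ∧ constantCoeff Y = 1

namespace IsPow

open PowerSeries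

theorem eq_one_of_zero {Q Y : PowerSeries ℂ} (hQ : constantCoeff Q = 1) (h : IsPow Q 0 Y) :
    Y = 1 := by
  have hQ0 : Q ≠ 0 := by
    rintro rfl
    simp at hQ
  have h1 := h.1
  simp only [map_zero, zero_mul, mul_eq_zero, hQ0, false_or] at h1
  apply derivative.ext
  · rw [h1, derivative_one]
  · simpa using h.2

theorem mul_exponent {Q Y Z : PowerSeries ℂ} {a b : ℂ} (hY : IsPow Q a Y) (hZ : IsPow Q b Z) :
    IsPow Q (a + b) (Y * Z) := by
  refine ⟨?_, by simp [hY.2, hZ.2]⟩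
  rw [Derivation.leibniz, smul_eq_mul, smul_eq_mul, map_add]
  linear_combination Z * hY.1 + Y * hZ.1

theorem mul_base {P Q Y Z : PowerSeries ℂ} {a : ℂ} (hY : IsPow P a Y) (hZ : IsPow Q a Z) :
    IsPow (P * Q) a (Y * Z) := by
  refine ⟨?_, by simp [hY.2, hZ.2]⟩
  simp only [Derivation.leibniz, smul_eq_mul]
  linear_combination Q * Z * hY.1 + P * Y * hZ.1

theorem mul_eq_one {Q Y Z : PowerSeries ℂ} {a : ℂ} (hQ : constantCoeff Q = 1) (hY : IsPow Q a Y)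
    (hZ : IsPow Q (-a) Z) : Y * Z = 1 :=
  eq_one_of_zero hQ (by simpa using hY.mul_exponent hZ)

theorem derivative_rescale (r : ℂ) (Y : PowerSeries ℂ) :
    derivative ℂ (rescale r Y) = C r * rescale r (derivative ℂ Y) := by
  ext n
  simp only [coeff_derivative, coeff_rescale, coeff_C_mul]
  ring

theorem rescale {Q Y : PowerSeries ℂ} {a : ℂ} (h : IsPow Q a Y) (r : ℂ) :
    IsPow (rescale r Q) a (rescale r Y) := by
  refine ⟨?_, ?_⟩
  · have h1 := congrArg (PowerSeries.rescale r) h.1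
    have h2 : PowerSeries.rescale r (C a) = C a := by
      ext n
      rw [coeff_rescale, coeff_C]
      split_ifs with hn <;> simp [hn]
    simp only [map_mul, h2] at h1
    rw [derivative_rescale, derivative_rescale]
    linear_combination C r * h1
  · rw [← coeff_zero_eq_constantCoeff_apply, coeff_rescale, pow_zero, one_mul,
      coeff_zero_eq_constantCoeff_apply, h.2]

theorem expand_two {Q Y : PowerSeries ℂ} {a : ℂ} (h : IsPow Q a Y) :
    IsPow (expand 2 two_ne_zero Q) a (expand 2 two_ne_zero Y) := by
  have key : ∀ Z : PowerSeries ℂ, derivative ℂ (expand 2 two_ne_zero Z) =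
      2 * X * expand 2 two_ne_zero (derivative ℂ Z) := by
    intro Z
    rw [expand_apply, derivative_subst (HasSubst.X_pow two_ne_zero), expand_apply, derivative_pow,
      derivative_X]
    push_cast
    ring
  refine ⟨?_, by rw [constantCoeff_expand, h.2]⟩
  have h1 := congrArg (expand 2 two_ne_zero) h.1
  simp only [map_mul, expand_C] at h1
  rw [key, key]
  linear_combination 2 * X * h1

end IsPow

/-! ### Rising factorials. -/

/-- The rising factorial. -/
def rf (a : ℂ) (n : ℕ) : ℂ := (ascPochhammer ℂ n).eval a

@[simp]
theorem rf_zero (a : ℂ) : rf a 0 = 1 := by simp [rf]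

theorem rf_succ (a : ℂ) (n : ℕ) : rf a (n + 1) = rf a n * (a + n) :=
  ascPochhammer_succ_eval n a

theorem rf_add (a : ℂ) (m n : ℕ) : rf a (m + n) = rf a m * rf (a + m) n := by
  induction n with
  | zero => simp
  | succ n ih =>
    rw [← add_assoc, rf_succ, rf_succ, ih]
    push_cast
    ring

theorem rf_succ_left (a : ℂ) (n : ℕ) : rf a (n + 1) = a * rf (a + 1) n := by
  rw [add_comm n, rf_add, rf_succ]
  simp

theorem rf_reflect (a : ℂ) (n : ℕ) : rf (1 - a - n) n = (-1) ^ n * rf a n := by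
  induction n with
  | zero => simp
  | succ n ih =>
    rw [rf_succ_left, rf_succ, pow_succ]
    have : (1 - a - ((n + 1 : ℕ) : ℂ) + 1) = 1 - a - n := by push_cast; ring
    rw [this, ih]
    push_cast
    ring

theorem rf_two_mul (a : ℂ) (n : ℕ) : rf (2 * a) (2 * n) = 4 ^ n * rf a n * rf (a + 1 / 2) n := by
  induction n with
  | zero => simp
  | succ n ih =>
    rw [show 2 * (n + 1) = 2 * n + 1 + 1 from rfl, rf_succ, rf_succ, rf_succ, rf_succ, ih]
    push_cast
    ring

/-! ### Explicit coefficients of Q_x^{-β} and their recurrence. -/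

/-- The terms of the coefficients of `(1 - 2xz + (x² - 1)z²)^{-β}`. -/
def powTerm (β x : ℂ) (j t : ℕ) : ℂ :=
  rf β j * rf (2 * β + 2 * j) t / ((Nat.factorial j : ℂ) * (Nat.factorial t : ℂ)) * x ^ t

/-- The coefficient of `z^n` in `(1 - 2xz + (x² - 1)z²)^{-β}`. -/
def powCoeff (β x : ℂ) (n : ℕ) : ℂ :=
  ∑ j ∈ Finset.range (n / 2 + 1), powTerm β x j (n - 2 * j)

theorem powCoeff_eq_sum_ite (β x : ℂ) {n N : ℕ} (h : n / 2 < N) :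
    powCoeff β x n =
      ∑ j ∈ Finset.range N, if 2 * j ≤ n then powTerm β x j (n - 2 * j) else 0 := by
  rw [powCoeff, ← Finset.sum_filter]
  refine Finset.sum_congr ?_ fun _ _ => rfl
  ext j
  simp only [Finset.mem_range, Finset.mem_filter]
  omega

theorem powTerm_zero_rec (β x : ℂ) (n : ℕ) :
    (n + 2) * powTerm β x 0 (n + 2) = 2 * (n + 1 + β) * x * powTerm β x 0 (n + 1)
      - (n + 2 * β) * x ^ 2 * powTerm β x 0 n := by
  have h : (Nat.factorial n : ℂ) ≠ 0 := by exact_mod_cast n.factorial_ne_zero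
  have h1 : (n : ℂ) + 1 ≠ 0 := by exact_mod_cast n.succ_ne_zero
  have h2 : (n : ℂ) + 1 + 1 ≠ 0 := by exact_mod_cast (n + 1).succ_ne_zero
  simp only [powTerm, rf_zero, rf_succ, Nat.factorial_succ, Nat.factorial_zero]
  push_cast
  field_simp
  ring

/-- The terms come from expanding ((1 - xz)² - z²)^{-β} in powers of z² and then of xz. The
recurrence of the coefficients already holds term by term, provided the -1 in x² - 1 is paired with
the summand of index j instead of j + 1. -/
theorem powTerm_succ_rec (β x : ℂ) (j t : ℕ) :
    (2 * j + t + 4) * powTerm β x (j + 1) (t + 2) =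
      2 * (2 * j + t + 3 + β) * x * powTerm β x (j + 1) (t + 1)
      - (2 * j + t + 2 + 2 * β) * (x ^ 2 * powTerm β x (j + 1) t - powTerm β x j (t + 2)) := by
  have h : (Nat.factorial t : ℂ) ≠ 0 := by exact_mod_cast t.factorial_ne_zero
  have h1 : (t : ℂ) + 1 ≠ 0 := by exact_mod_cast t.succ_ne_zero
  have h2 : (t : ℂ) + 1 + 1 ≠ 0 := by exact_mod_cast (t + 1).succ_ne_zero
  have h3 : (Nat.factorial j : ℂ) ≠ 0 := by exact_mod_cast j.factorial_ne_zero
  have h4 : (j : ℂ) + 1 ≠ 0 := by exact_mod_cast j.succ_ne_zero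
  have e : rf (2 * β + 2 * j) (t + 2) =
      (2 * β + 2 * j) * (2 * β + 2 * j + 1) * rf (2 * β + 2 * ((j + 1 : ℕ) : ℂ)) t := by
    have e2 : 2 * β + 2 * ((j + 1 : ℕ) : ℂ) = 2 * β + 2 * j + 1 + 1 := by push_cast; ring
    rw [rf_succ_left, rf_succ_left, e2, mul_assoc]
  simp only [powTerm, e, rf_succ β, rf_succ _ (t + 1), rf_succ _ t, Nat.factorial_succ]
  push_cast
  field_simp
  ring

theorem powCoeff_rec (β x : ℂ) (n : ℕ) :
    (n + 2) * powCoeff β x (n + 2) = 2 * (n + 1 + β) * x * powCoeff β x (n + 1)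
      - (n + 2 * β) * (x ^ 2 - 1) * powCoeff β x n := by
  have hn : n / 2 < n + 1 := by omega
  -- All sums are padded with zeros to a common range. The one belonging to the -1 in x² - 1 is one
  -- shorter, so that it lines up with the others once their j = 0 terms are split off.
  rw [powCoeff_eq_sum_ite β x (show (n + 2) / 2 < n + 2 by omega),
    powCoeff_eq_sum_ite β x (show (n + 1) / 2 < n + 2 by omega), mul_sub, sub_mul]
  nth_rw 1 [powCoeff_eq_sum_ite β x (show n / 2 < n + 2 by omega)]
  rw [powCoeff_eq_sum_ite β x hn, Finset.sum_range_succ' _ (n + 1),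
    Finset.sum_range_succ' _ (n + 1), Finset.sum_range_succ' _ (n + 1)]
  have key : ∀ j : ℕ,
      (n + 2) * (if 2 * (j + 1) ≤ n + 2 then powTerm β x (j + 1) (n + 2 - 2 * (j + 1)) else 0) =
      2 * (n + 1 + β) * x *
        (if 2 * (j + 1) ≤ n + 1 then powTerm β x (j + 1) (n + 1 - 2 * (j + 1)) else 0)
      - (n + 2 * β) * x ^ 2 *
        (if 2 * (j + 1) ≤ n then powTerm β x (j + 1) (n - 2 * (j + 1)) else 0)
      + (n + 2 * β) * (if 2 * j ≤ n then powTerm β x j (n - 2 * j) else 0) := by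
    intro j
    have h3 : (Nat.factorial j : ℂ) ≠ 0 := by exact_mod_cast j.factorial_ne_zero
    have h4 : (j : ℂ) + 1 ≠ 0 := by exact_mod_cast j.succ_ne_zero
    rcases lt_or_ge n (2 * j) with h | h
    · rw [if_neg (by omega), if_neg (by omega), if_neg (by omega), if_neg (by omega)]
      ring
    obtain ⟨t, rfl⟩ := Nat.exists_eq_add_of_le h
    -- For t = 0 and t = 1 some terms drop out of range, so the termwise recurrence does not apply
    -- and these two boundary cases are computed directly.
    match t with
    | 0 =>
      rw [if_pos (by omega), if_neg (by omega), if_neg (by omega), if_pos (by omega)]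
      simp only [show 2 * j + 0 + 2 - 2 * (j + 1) = 0 by omega,
        show 2 * j + 0 - 2 * j = 0 by omega, powTerm, rf_succ, rf_zero, Nat.factorial_succ]
      push_cast
      field_simp
      ring
    | 1 =>
      rw [if_pos (by omega), if_pos (by omega), if_neg (by omega), if_pos (by omega)]
      simp only [show 2 * j + 1 + 2 - 2 * (j + 1) = 0 + 1 by omega,
        show 2 * j + 1 + 1 - 2 * (j + 1) = 0 by omega,
        show 2 * j + 1 - 2 * j = 0 + 1 by omega, powTerm, rf_succ, rf_zero, Nat.factorial_succ]
      push_cast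
      field_simp
      ring
    | t + 2 =>
      rw [if_pos (by omega), if_pos (by omega), if_pos (by omega), if_pos (by omega)]
      simp only [show 2 * j + (t + 2) + 2 - 2 * (j + 1) = t + 2 by omega,
        show 2 * j + (t + 2) + 1 - 2 * (j + 1) = t + 1 by omega,
        show 2 * j + (t + 2) - 2 * (j + 1) = t by omega,
        show 2 * j + (t + 2) - 2 * j = t + 2 by omega]
      push_cast
      linear_combination powTerm_succ_rec β x j t
  have h0 := powTerm_zero_rec β x n
  have hs := Finset.sum_congr (rfl : Finset.range (n + 1) = Finset.range (n + 1))
    fun j _ => key j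
  simp only [Finset.sum_add_distrib, Finset.sum_sub_distrib, ← Finset.mul_sum] at hs
  simp only [Nat.mul_zero, Nat.zero_le, if_true, Nat.sub_zero]
  linear_combination hs + h0

open PowerSeries in
/-- The power series `(1 - 2xz + (x² - 1)z²)^{-β}`. -/
def powSeries (β x : ℂ) : PowerSeries ℂ := PowerSeries.mk (powCoeff β x)

open PowerSeries in
/-- The power series `1 - 2xz + (x² - 1)z²`. -/
def quadSeries (x : ℂ) : PowerSeries ℂ := 1 - C (2 * x) * X + C (x ^ 2 - 1) * X ^ 2

/-! ### The product formula for Q_x(z)^{-β} Q_x(-z)^{-β}. -/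

section
open PowerSeries

theorem constantCoeff_quadSeries (x : ℂ) : constantCoeff (quadSeries x) = 1 := by
  simp [quadSeries]

theorem isPow_powSeries (β x : ℂ) : IsPow (quadSeries x) (-β) (powSeries β x) := by
  obtain ⟨D, hD⟩ : ∃ D, D = x ^ 2 - 1 := ⟨_, rfl⟩
  obtain ⟨A, hA⟩ : ∃ A, A = 2 * x := ⟨_, rfl⟩
  have hrec : ∀ n : ℕ, (n + 2) * powCoeff β x (n + 2) = (n + 1 + β) * A * powCoeff β x (n + 1)
      - (n + 2 * β) * D * powCoeff β x n := fun n => by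
    rw [powCoeff_rec, hA, hD]
    ring
  refine ⟨?_, ?_⟩
  · have e1 : quadSeries x * derivative ℂ (powSeries β x) = derivative ℂ (powSeries β x)
        - C A * (X * derivative ℂ (powSeries β x))
        + C D * (X * (X * derivative ℂ (powSeries β x))) := by
      rw [quadSeries, ← hA, ← hD]
      ring
    have e2 : C (-β) * derivative ℂ (quadSeries x) * powSeries β x =
        C (A * β) * powSeries β x - C (2 * β * D) * (X * powSeries β x) := by
      rw [quadSeries, ← hA, ← hD]
      simp only [map_add, map_sub, Derivation.leibniz, derivative_X, derivative_C,
        derivative_one, derivative_pow, smul_eq_mul, map_neg, map_mul, map_ofNat C]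
      push_cast
      ring
    rw [e1, e2]
    ext n
    rw [map_add, map_sub, map_sub, coeff_C_mul, coeff_C_mul, coeff_C_mul, coeff_C_mul]
    rcases n with _ | _ | n
    · have h1 : powCoeff β x 1 = β * A := by
        simp [powCoeff, powTerm, rf_succ, hA]
        ring
      have h0 : powCoeff β x 0 = 1 := by
        simp [powCoeff, powTerm]
      simp only [coeff_zero_X_mul, coeff_derivative, powSeries, coeff_mk, h1, h0, zero_add]
      push_cast
      ring
    · have h := hrec 0
      simp only [coeff_succ_X_mul, coeff_zero_X_mul, coeff_derivative, powSeries, coeff_mk]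
      push_cast at h ⊢
      linear_combination h
    · have h := hrec (n + 1)
      simp only [coeff_succ_X_mul, coeff_derivative, powSeries, coeff_mk]
      push_cast at h ⊢
      linear_combination h
  · simp [powSeries, ← coeff_zero_eq_constantCoeff_apply, powCoeff, powTerm]

/-- A power W with the opposite exponent is inverse to both Y and Z, so the differential equation
need not be solved recursively. -/
theorem IsPow.unique {Q Y Z : PowerSeries ℂ} {a : ℂ} {W : PowerSeries ℂ}
    (hQ : constantCoeff Q = 1) (hY : IsPow Q a Y) (hZ : IsPow Q a Z) (hW : IsPow Q (-a) W) :
    Y = Z := by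
  have h1 := hY.mul_eq_one hQ hW
  have h2 := hZ.mul_eq_one hQ hW
  linear_combination (-Y) * h2 + Z * h1

theorem quadSeries_mul_rescale {x : ℂ} (hx : x ≠ 0) :
    quadSeries x * rescale (-1) (quadSeries x) =
      expand 2 two_ne_zero (rescale (2 * x) (quadSeries ((1 + x ^ 2) / (2 * x)))) := by
  have hC : ∀ r a : ℂ, rescale r (C a) = C a := fun r a => by
    ext n
    rw [coeff_rescale, coeff_C]
    split_ifs with hn <;> simp [hn]
  simp only [quadSeries, map_add, map_sub, map_one, map_mul (rescale _),
    map_mul (expand 2 two_ne_zero), map_pow (rescale _), map_pow (expand 2 two_ne_zero), hC,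
    rescale_X, expand_C, expand_X]
  have h1 : C (2 * ((1 + x ^ 2) / (2 * x))) * C (2 * x) = (C (2 * (1 + x ^ 2)) : PowerSeries ℂ) := by
    rw [← map_mul]
    congr 1
    field_simp
  have h2 : (C (((1 + x ^ 2) / (2 * x)) ^ 2) - 1) * C (2 * x) ^ 2 =
      (C ((1 - x ^ 2) ^ 2) : PowerSeries ℂ) := by
    rw [← map_one C, ← map_sub, ← map_pow, ← map_mul]
    congr 1
    field_simp
    ring
  have e : ∀ A B D : PowerSeries ℂ, 1 - A * (B * X ^ 2) + D * (B * X ^ 2) ^ 2 =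
      1 - A * B * X ^ 2 + D * B ^ 2 * X ^ 4 := fun A B D => by ring
  rw [e, h1, h2]
  simp only [map_mul, map_add, map_sub, map_pow, map_one, map_neg, map_ofNat]
  ring

/-- Both sides are the power -β of the same series, by `quadSeries_mul_rescale`. -/
theorem powSeries_mul_rescale (β : ℂ) {x : ℂ} (hx : x ≠ 0) :
    powSeries β x * rescale (-1) (powSeries β x) =
      expand 2 two_ne_zero (rescale (2 * x) (powSeries β ((1 + x ^ 2) / (2 * x)))) := by
  have hp : ∀ γ, IsPow (quadSeries x * rescale (-1) (quadSeries x)) (-γ)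
      (powSeries γ x * rescale (-1) (powSeries γ x)) := fun γ =>
    (isPow_powSeries γ x).mul_base ((isPow_powSeries γ x).rescale (-1))
  refine (hp β).unique ?_ ?_ (hp (-β))
  · rw [map_mul, constantCoeff_quadSeries, ← coeff_zero_eq_constantCoeff_apply, coeff_rescale,
      coeff_zero_eq_constantCoeff_apply, constantCoeff_quadSeries]
    simp
  · rw [quadSeries_mul_rescale hx]
    exact ((isPow_powSeries β _).rescale _).expand_two

theorem powSeries_eq_mul (β : ℂ) {x : ℂ} (hx : x ≠ 0) :
    powSeries β x =
      expand 2 two_ne_zero (rescale (2 * x) (powSeries β ((1 + x ^ 2) / (2 * x)))) *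
        rescale (-1) (powSeries (-β) x) := by
  have h := (isPow_powSeries β x).mul_eq_one (constantCoeff_quadSeries x)
    (isPow_powSeries (-β) x)
  have h' := congrArg (rescale (-1 : ℂ)) h
  rw [map_mul, map_one] at h'
  rw [← powSeries_mul_rescale β hx]
  linear_combination (-powSeries β x) * h'

end

/-! ### Comparison of coefficients. -/

section
open PowerSeries

theorem two_mul_pow_mul_powCoeff (β : ℂ) {x : ℂ} (hx : x ≠ 0) (l : ℕ) :
    (2 * x) ^ l * powCoeff β ((1 + x ^ 2) / (2 * x)) l =
      ∑ n ∈ Finset.range (2 * l + 1),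
        (-1) ^ (2 * l - n) * powCoeff β x n * powCoeff β x (2 * l - n) := by
  have h := congrArg (coeff (2 * l)) (powSeries_mul_rescale β hx)
  rw [coeff_expand_mul, coeff_rescale, coeff_mul,
    Finset.Nat.sum_antidiagonal_eq_sum_range_succ_mk] at h
  simp only [powSeries, coeff_mk, coeff_rescale] at h
  rw [← h]
  exact Finset.sum_congr rfl fun n _ => by ring

theorem powCoeff_eq_sum (β : ℂ) {x : ℂ} (hx : x ≠ 0) (k : ℕ) :
    powCoeff β x k = ∑ m ∈ Finset.range (k / 2 + 1),
      (-1) ^ (k - 2 * m) * (2 * x) ^ m * powCoeff β ((1 + x ^ 2) / (2 * x)) m *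
        powCoeff (-β) x (k - 2 * m) := by
  have h := congrArg (coeff k) (powSeries_eq_mul β hx)
  rw [coeff_mul, Finset.Nat.sum_antidiagonal_eq_sum_range_succ_mk] at h
  rw [powSeries, coeff_mk] at h
  rw [h]
  symm
  -- The first factor is a series in z², so only even indices contribute to the convolution.
  refine Finset.sum_of_injOn (fun m => 2 * m) (fun a _ b _ hab => by simpa using hab) ?_ ?_ ?_
  · intro m hm
    simp only [Finset.coe_range, Set.mem_Iio] at hm ⊢
    omega
  · intro n hn hn'
    have hodd : ¬ 2 ∣ n := by
      rintro ⟨m, rfl⟩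
      apply hn'
      refine ⟨m, ?_, rfl⟩
      simp only [Finset.coe_range, Set.mem_Iio, Finset.mem_range] at hn ⊢
      omega
    simp only [coeff_expand_of_not_dvd 2 two_ne_zero _ hodd, zero_mul]
  · intro m _
    simp only [coeff_expand_mul, coeff_rescale, powSeries, coeff_mk]
    ring

end

/-! ### Gegenbauer polynomials as normalised coefficients of Q_x^{-β}. -/

/-- The sums agree term by term: reflection turns (τ)_{k-j} into ±(β + 1/2 + j)_{k-j}, and
duplication splits (2β)_{2j}. The relation is left undivided, since either rising factorial may
vanish. -/
theorem rf_mul_gegenbauerC {k : ℕ} {τ β : ℂ} (x : ℂ) (h : τ + k + β = 1 / 2) :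
    rf (2 * β) k * gegenbauerC k τ x = (-2) ^ k * rf (β + 1 / 2) k * powCoeff β x k := by
  rw [gegenbauerC, powCoeff, Finset.mul_sum, Finset.mul_sum]
  refine Finset.sum_congr rfl fun j hj => ?_
  obtain ⟨t, rfl⟩ := Nat.exists_eq_add_of_le
    (show 2 * j ≤ k by have := Finset.mem_range.1 hj; omega)
  have e1 : 2 * j + t - j = j + t := by omega
  have e2 : 2 * j + t - 2 * j = t := by omega
  have e3 : (ascPochhammer ℂ (j + t)).eval τ = (-1) ^ (j + t) * rf (β + 1 / 2 + j) (j + t) := by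
    rw [← rf_reflect, rf]
    congr 1
    push_cast at h ⊢
    linear_combination h
  have e4 : rf (β + 1 / 2) (2 * j + t) = rf (β + 1 / 2) j * rf (β + 1 / 2 + j) (j + t) := by
    rw [← rf_add]
    congr 1
    omega
  have e5 : rf (2 * β) (2 * j + t) =
      4 ^ j * rf β j * rf (β + 1 / 2) j * rf (2 * β + 2 * j) t := by
    rw [rf_add, rf_two_mul]
    push_cast
    rfl
  have e6 : (-2 : ℂ) ^ (2 * j + t) = 4 ^ j * (-1) ^ t * 2 ^ t := by
    rw [pow_add, pow_mul, mul_assoc, ← mul_pow]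
    norm_num
  have e7 : (-1 : ℂ) ^ j * (-1) ^ (j + t) = (-1) ^ t := by
    rw [pow_add, ← mul_assoc, ← mul_pow]
    norm_num
  rw [e1, e2, e3, e4, e5, e6, powTerm, mul_pow, ← mul_assoc ((-1 : ℂ) ^ j), e7]
  ring

theorem poch_natCast (a : ℂ) (n : ℕ) : poch a n = rf a n := rfl

theorem poch_neg_succ (a : ℂ) (n : ℕ) :
    poch a (-((n + 1 : ℕ) : ℤ)) = (rf (a - ((n + 1 : ℕ) : ℂ)) (n + 1))⁻¹ := by
  rw [show (-((n + 1 : ℕ) : ℤ)) = Int.negSucc n from rfl, poch, rf]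
  push_cast
  rfl

theorem poch_neg_natCast (a : ℂ) (n : ℕ) : poch a (-(n : ℤ)) = (rf (a - n) n)⁻¹ := by
  cases n with
  | zero => simpa using poch_natCast a 0
  | succ n => exact poch_neg_succ a n

/-- This is (a)_{n-l} (a + n - l)_{2l-n} = (a)_l. For n < l the first factor is an inverse, and `h`
keeps it from being the default value 0⁻¹ = 0. -/
theorem poch_sub_mul_rf {a : ℂ} {l n N : ℕ} (hn : n + N = 2 * l) (h : rf (a - l) l ≠ 0) :
    poch a ((n : ℤ) - l) * rf (a + n - l) N = rf a l := by
  rcases le_total l n with hl | hl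
  · obtain ⟨d, rfl⟩ := Nat.exists_eq_add_of_le hl
    obtain rfl : l = d + N := by omega
    rw [show ((d + N + d : ℕ) : ℤ) - (d + N : ℕ) = (d : ℕ) by push_cast; ring, poch_natCast,
      rf_add]
    congr 2
    push_cast
    ring
  · obtain ⟨d, rfl⟩ := Nat.exists_eq_add_of_le hl
    obtain rfl : N = d + (n + d) := by omega
    have e : a - (n + d : ℕ) + n = a - d := by push_cast; ring
    rw [rf_add, e] at h
    rw [show (n : ℤ) - (n + d : ℕ) = -(d : ℕ) by push_cast; ring, poch_neg_natCast,
      show a + n - (n + d : ℕ) = a - d by push_cast; ring, rf_add, sub_add_cancel,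
      inv_mul_cancel_left₀ (right_ne_zero_of_mul h)]

theorem inv_poch_sub_mul_rf {a : ℂ} {l n N : ℕ} (hn : n + N = 2 * l) (h : rf a l ≠ 0) :
    (poch a ((n : ℤ) - l))⁻¹ * rf a l = rf (a + n - l) N := by
  rcases le_total l n with hl | hl
  · obtain ⟨d, rfl⟩ := Nat.exists_eq_add_of_le hl
    obtain rfl : l = d + N := by omega
    rw [rf_add] at h
    rw [show ((d + N + d : ℕ) : ℤ) - (d + N : ℕ) = (d : ℕ) by push_cast; ring, poch_natCast,
      rf_add, inv_mul_cancel_left₀ (left_ne_zero_of_mul h)]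
    congr 1
    push_cast
    ring
  · obtain ⟨d, rfl⟩ := Nat.exists_eq_add_of_le hl
    obtain rfl : N = d + (n + d) := by omega
    rw [show (n : ℤ) - (n + d : ℕ) = -(d : ℕ) by push_cast; ring, poch_neg_natCast, inv_inv,
      show a + n - (n + d : ℕ) = a - d by push_cast; ring, rf_add _ d, sub_add_cancel]

theorem neg_one_pow_mul_self (n : ℕ) : (-1 : ℂ) ^ n * (-1) ^ n = 1 := by
  rw [← mul_pow]
  norm_num

/-- The relation of `rf_mul_gegenbauerC`, with both rising factorials reflected. -/
theorem rf_reflect_mul_gegenbauerC {k : ℕ} {τ β : ℂ} (x : ℂ) (h : τ + k + β = 1 / 2) :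
    rf (1 - 2 * β - k) k * gegenbauerC k τ x = (-2) ^ k * rf τ k * powCoeff β x k := by
  have e : τ = 1 - (β + 1 / 2) - k := by linear_combination h
  have h1 := rf_mul_gegenbauerC x h
  rw [rf_reflect, show rf τ k = (-1) ^ k * rf (β + 1 / 2) k by rw [e, rf_reflect]]
  linear_combination (-1) ^ k * h1

/-! ### The two expansions away from the exceptional parameters. -/

theorem gegenbauerC_eq_sum1 {k : ℕ} {x μ : ℂ} (hx : x ≠ 0) (h1 : rf (1 / 2 + μ + k) k ≠ 0)
    (h2 : rf (2 * μ + k + 1) k ≠ 0) : gegenbauerC k (μ + 1 / 2) x = sum1 k μ x := by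
  apply mul_left_cancel₀ h2
  -- τ + k + β = 1/2 with τ = μ + 1/2 forces β = -μ - k. The factors C_m below use the same β, and
  -- the factors C_{k-2m} use -β.
  have hC : rf (2 * μ + k + 1) k * gegenbauerC k (μ + 1 / 2) x =
      (-2) ^ k * rf (μ + 1 / 2) k * powCoeff (-μ - k) x k := by
    rw [← rf_reflect_mul_gegenbauerC x (by ring)]
    congr 2
    ring
  rw [hC, powCoeff_eq_sum _ hx, sum1, Finset.mul_sum, Finset.mul_sum]
  refine Finset.sum_congr rfl fun m hm => ?_
  obtain ⟨n, hn⟩ := Nat.exists_eq_add_of_le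
    (show 2 * m ≤ k by have := Finset.mem_range.1 hm; omega)
  have hnk : k - 2 * m = n := by omega
  have hkc : (k : ℂ) = 2 * m + n := by rw [hn]; push_cast; ring
  have hB : rf (2 * k + 2 * μ) n * gegenbauerC n (1 / 2 - 2 * k + 2 * m - μ) x =
      (-2) ^ n * rf (1 / 2 + μ + k) n * powCoeff (-(-μ - k)) x n := by
    have h := rf_mul_gegenbauerC (k := n) (τ := 1 / 2 - 2 * k + 2 * m - μ) (β := -(-μ - k)) x
      (by linear_combination -hkc)
    rw [show 2 * (-(-μ - k)) = 2 * k + 2 * μ by ring,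
      show -(-μ - k) + 1 / 2 = 1 / 2 + μ + k by ring] at h
    exact h
  have hH : rf (2 * μ + k + 1 + (m + n : ℕ)) m *
        gegenbauerC m (k - m + μ + 1 / 2) ((1 + x ^ 2) / (2 * x)) =
      (-2) ^ m * rf (μ + 1 / 2 + (m + n : ℕ)) m *
        powCoeff (-μ - k) ((1 + x ^ 2) / (2 * x)) m := by
    have h := rf_reflect_mul_gegenbauerC (k := m) (τ := k - m + μ + 1 / 2) (β := -μ - k)
      ((1 + x ^ 2) / (2 * x)) (by ring)
    rw [show 1 - 2 * (-μ - k) - m = 2 * μ + k + 1 + (m + n : ℕ) by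
        push_cast; linear_combination hkc] at h
    rw [h]
    congr 3
    push_cast
    linear_combination hkc
  have hS : rf (1 / 2 + μ + k) n ≠ 0 := by
    have h := h1
    nth_rw 2 [show k = n + 2 * m by omega] at h
    rw [rf_add] at h
    exact left_ne_zero_of_mul h
  have hk : k = (m + n) + m := by omega
  have hb : rf (2 * μ + k + 1) k =
      rf (2 * μ + k + 1) (m + n) * rf (2 * μ + k + 1 + (m + n : ℕ)) m := by
    rw [← rf_add, ← hk]
  have ha : rf (μ + 1 / 2) k = rf (μ + 1 / 2) (m + n) * rf (μ + 1 / 2 + (m + n : ℕ)) m := by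
    rw [← rf_add, ← hk]
  have hb0 : rf (2 * μ + k + 1) (m + n) ≠ 0 := by
    rw [hb] at h2
    exact left_ne_zero_of_mul h2
  have hL : Lambda1 k m μ = (-1) ^ (k + m) * 2 ^ (2 * m) * rf (2 * k + 2 * μ) n *
      rf (μ + 1 / 2) (m + n) / (rf (1 / 2 + μ + k) n * rf (2 * μ + k + 1) (m + n)) := by
    rw [Lambda1, show (k : ℤ) - 2 * m = (n : ℕ) by omega,
      show (k : ℤ) - m = (m + n : ℕ) by omega]
    rfl
  rw [hnk, hL, hb, ha]
  generalize rf (2 * k + 2 * μ) n = P at *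
  generalize rf (1 / 2 + μ + k) n = S at *
  generalize rf (2 * μ + k + 1) (m + n) = b at *
  generalize rf (2 * μ + k + 1 + (m + n : ℕ)) m = b' at *
  generalize rf (μ + 1 / 2) (m + n) = a at *
  generalize rf (μ + 1 / 2 + (m + n : ℕ)) m = a' at *
  generalize gegenbauerC n _ x = B at *
  generalize gegenbauerC m _ _ = H at *
  generalize powCoeff _ x n = φ at *
  generalize powCoeff _ _ m = ψ at *
  have hpow : (-2 : ℂ) ^ k * (-1) ^ n * (2 * x) ^ m =
      (-1) ^ (k + m) * 2 ^ (2 * m) * x ^ m * (-2) ^ n * (-2) ^ m := by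
    have h := neg_one_pow_mul_self m
    rw [hn, show (-2 : ℂ) = (-1) * 2 by norm_num]
    simp only [mul_pow, pow_add, pow_mul]
    norm_num
    linear_combination (-(-1) ^ n * (-1) ^ n * 4 ^ m * 2 ^ n * 2 ^ m * x ^ m) * h
  calc (-2) ^ k * (a * a') * ((-1) ^ n * (2 * x) ^ m * ψ * φ)
      = a * ((-2 : ℂ) ^ k * (-1) ^ n * (2 * x) ^ m) * (a' * ψ) * φ := by ring
    _ = (-1) ^ (k + m) * 2 ^ (2 * m) * a * x ^ m * ((-2) ^ n * S * φ) * ((-2) ^ m * a' * ψ) / S := by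
        rw [hpow]
        field_simp
    _ = _ := by
        rw [← hB, ← hH]
        field_simp

theorem pow_mul_gegenbauerC_eq_sum2 {l : ℕ} {x μ : ℂ} (hx : x ≠ 0)
    (h1 : rf (1 / 2 - 2 * l - μ) (2 * l) ≠ 0) (h2 : rf (2 * μ + 3 * l + 1) l ≠ 0)
    (h3 : rf (μ + 1 / 2) l ≠ 0) :
    x ^ l * gegenbauerC l (μ + l + 1 / 2) ((1 + x ^ 2) / (2 * x)) = sum2 l μ x := by
  apply mul_left_cancel₀ h2
  have hC : rf (2 * μ + 3 * l + 1) l *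
        gegenbauerC l (μ + l + 1 / 2) ((1 + x ^ 2) / (2 * x)) =
      (-2) ^ l * rf (μ + l + 1 / 2) l * powCoeff (-2 * l - μ) ((1 + x ^ 2) / (2 * x)) l := by
    rw [← rf_reflect_mul_gegenbauerC _ (by ring)]
    congr 2
    ring
  have hsum : rf (2 * μ + 3 * l + 1) l *
        (x ^ l * gegenbauerC l (μ + l + 1 / 2) ((1 + x ^ 2) / (2 * x))) =
      (-1) ^ l * rf (μ + l + 1 / 2) l *
        ((2 * x) ^ l * powCoeff (-2 * l - μ) ((1 + x ^ 2) / (2 * x)) l) := by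
    rw [show (-2 : ℂ) ^ l = (-1) ^ l * 2 ^ l by rw [← mul_pow]; norm_num] at hC
    rw [mul_pow]
    linear_combination x ^ l * hC
  rw [hsum, two_mul_pow_mul_powCoeff _ hx, sum2, Finset.mul_sum, Finset.mul_sum]
  refine Finset.sum_congr rfl fun n hn => ?_
  obtain ⟨N, hN⟩ := Nat.exists_eq_add_of_le
    (show n ≤ 2 * l by have := Finset.mem_range.1 hn; omega)
  have hNl : 2 * l - n = N := by omega
  have hlc : 2 * (l : ℂ) = n + N := by exact_mod_cast hN
  have hX : rf (-4 * l - 2 * μ) n * gegenbauerC n (1 / 2 + 2 * l + μ - n) x =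
      (-2) ^ n * rf (1 / 2 - 2 * l - μ) n * powCoeff (-2 * l - μ) x n := by
    have h := rf_mul_gegenbauerC (k := n) (τ := 1 / 2 + 2 * l + μ - n) (β := -2 * l - μ) x (by ring)
    rw [show 2 * (-2 * l - μ) = -4 * l - 2 * μ by ring,
      show -2 * l - μ + 1 / 2 = 1 / 2 - 2 * l - μ by ring] at h
    exact h
  have hY : rf (2 * μ + 3 * l + 1 + n - l) N * gegenbauerC N (μ + n + 1 / 2) x =
      (-2) ^ N * rf (μ + l + 1 / 2 + n - l) N * powCoeff (-2 * l - μ) x N := by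
    have h := rf_reflect_mul_gegenbauerC (k := N) (τ := μ + n + 1 / 2) (β := -2 * l - μ) x
      (by linear_combination -hlc)
    rw [show 1 - 2 * (-2 * l - μ) - N = 2 * μ + 3 * l + 1 + n - l by
      linear_combination hlc] at h
    rw [h]
    congr 3
    ring
  have hP := poch_sub_mul_rf (a := μ + l + 1 / 2) hN.symm (by
    rwa [show μ + l + 1 / 2 - l = μ + 1 / 2 by ring])
  have hR := inv_poch_sub_mul_rf hN.symm h2
  have hq : rf (1 / 2 - 2 * l - μ) n ≠ 0 := by
    rw [hN, rf_add] at h1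
    exact left_ne_zero_of_mul h1
  rw [hNl, Lambda2, poch_natCast, poch_natCast]
  generalize rf (-4 * l - 2 * μ) n = p at *
  generalize rf (1 / 2 - 2 * l - μ) n = q at *
  generalize rf (2 * μ + 3 * l + 1 + n - l) N = b' at *
  generalize rf (μ + l + 1 / 2 + n - l) N = a' at *
  generalize rf (2 * μ + 3 * l + 1) l = b at *
  generalize rf (μ + l + 1 / 2) l = a at *
  generalize poch (μ + l + 1 / 2) _ = P at *
  generalize poch (2 * μ + 3 * l + 1) _ = R at *
  generalize gegenbauerC n _ x = X at *
  generalize gegenbauerC N _ x = Y at *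
  generalize powCoeff _ x n = φ at *
  generalize powCoeff _ x N = ψ at *
  have hpow : (-2 : ℂ) ^ n * (-2) ^ N = 2 ^ (2 * l) := by
    rw [← pow_add, ← hN, pow_mul, pow_mul]
    norm_num
  have hsign : (-1 : ℂ) ^ N = (-1) ^ n := by
    have h : (-1 : ℂ) ^ n * (-1) ^ N = 1 := by
      rw [← pow_add, ← hN, pow_mul]
      norm_num
    linear_combination (-1) ^ n * h - (-1) ^ N * neg_one_pow_mul_self n
  symm
  calc b * ((-1) ^ (n + l) * p * P / (2 ^ (2 * l) * q * R) * X * Y)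
      = (-1) ^ (n + l) * P * (p * X) * ((R⁻¹ * b) * Y) / (2 ^ (2 * l) * q) := by
        rw [div_eq_mul_inv, div_eq_mul_inv, mul_inv _ R]
        ring
    _ = (-1) ^ (n + l) * (P * a') * ((-2) ^ n * (-2) ^ N) * q * φ * ψ / (2 ^ (2 * l) * q) := by
        rw [hR, hX, hY]
        ring
    _ = _ := by
        rw [hP, hpow, hsign, pow_add]
        field_simp

/-! ### Limits at the exceptional parameters. -/

theorem eventually_punctured_ne (μ c : ℂ) : ∀ᶠ ν in 𝓝[≠] μ, ν ≠ c := by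
  by_cases h : μ = c
  · exact h ▸ self_mem_nhdsWithin
  · exact nhdsWithin_le_nhds (isOpen_ne.mem_nhds h)

theorem eventually_rf_ne_zero {c : ℂ} (hc : c ≠ 0) (d μ : ℂ) (n : ℕ) :
    ∀ᶠ ν in 𝓝[≠] μ, rf (c * ν + d) n ≠ 0 := by
  induction n with
  | zero => simp
  | succ n ih =>
    filter_upwards [ih, eventually_punctured_ne μ (-(d + n) / c)] with ν h1 h2
    rw [rf_succ]
    refine mul_ne_zero h1 fun h => h2 ?_
    rw [eq_div_iff hc]
    linear_combination h

theorem continuous_gegenbauerC (k : ℕ) (x : ℂ) : Continuous fun τ => gegenbauerC k τ x := by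
  unfold gegenbauerC
  fun_prop

end

theorem mainTheorem10 :
    (∀ (k : ℕ) (x : ℂ), x ≠ 0 →
      (∀ μ : ℂ, poch (1 / 2 + μ + k) k ≠ 0 → poch (2 * μ + k + 1) k ≠ 0 →
        gegenbauerC k (μ + 1 / 2) x = sum1 k μ x) ∧
      (∀ μ : ℂ, Tendsto (fun ν : ℂ => sum1 k ν x) (𝓝[≠] μ)
        (𝓝 (gegenbauerC k (μ + 1 / 2) x)))) ∧
    (∀ (l : ℕ) (x : ℂ), x ≠ 0 →
      (∀ μ : ℂ, poch (1 / 2 - 2 * l - μ) (2 * l) ≠ 0 → poch (2 * μ + 3 * l + 1) l ≠ 0 →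
        poch (μ + 1 / 2) l ≠ 0 →
        x ^ l * gegenbauerC l (μ + l + 1 / 2) ((1 + x ^ 2) / (2 * x)) = sum2 l μ x) ∧
      (∀ μ : ℂ, Tendsto (fun ν : ℂ => sum2 l ν x) (𝓝[≠] μ)
        (𝓝 (x ^ l * gegenbauerC l (μ + l + 1 / 2) ((1 + x ^ 2) / (2 * x)))))) := by
  refine ⟨fun k x hx => ⟨fun μ h1 h2 => gegenbauerC_eq_sum1 hx h1 h2, fun μ => ?_⟩,
    fun l x hx => ⟨fun μ h1 h2 h3 => pow_mul_gegenbauerC_eq_sum2 hx ?_ h2 h3, fun μ => ?_⟩⟩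
  · have hc : Continuous fun ν => gegenbauerC k (ν + 1 / 2) x :=
      (continuous_gegenbauerC k x).comp (by fun_prop)
    refine ((hc.tendsto μ).mono_left nhdsWithin_le_nhds).congr' ?_
    filter_upwards [eventually_rf_ne_zero one_ne_zero (1 / 2 + k) μ k,
      eventually_rf_ne_zero two_ne_zero (k + 1) μ k] with ν h1 h2
    refine gegenbauerC_eq_sum1 hx ?_ ?_
    · convert h1 using 2
      ring
    · convert h2 using 2
      ring
  · rwa [← poch_natCast, Nat.cast_mul, Nat.cast_ofNat]
  · have hc : Continuous fun ν => x ^ l *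
        gegenbauerC l (ν + l + 1 / 2) ((1 + x ^ 2) / (2 * x)) :=
      continuous_const.mul ((continuous_gegenbauerC l _).comp (by fun_prop))
    refine ((hc.tendsto μ).mono_left nhdsWithin_le_nhds).congr' ?_
    filter_upwards [eventually_rf_ne_zero (neg_ne_zero.2 one_ne_zero) (1 / 2 - 2 * l) μ (2 * l),
      eventually_rf_ne_zero two_ne_zero (3 * l + 1) μ l,
      eventually_rf_ne_zero one_ne_zero (1 / 2) μ l] with ν h1 h2 h3
    refine pow_mul_gegenbauerC_eq_sum2 hx ?_ ?_ ?_
    · convert h1 using 2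
      ring
    · convert h2 using 2
      ring
    · convert h3 using 2
      ring
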